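/- Let $d\in\mathbb N$ and let $X\subset\mathbb R^d$ be a compact set with $\overline{\operatorname{int}X}=X$ such that $X$ is convex, or $\partial X$ is smooth (of class $C^1$ suffices), or, more generally, $X$ satisfies the cone condition: there are $\gamma\in(0,\pi/2)$ and $l>0$ such that every $x\in\partial X$ is the vertex of an open cone of half-angle $\gamma$ and altitude $l$ contained in $\operatorname{int}X$. Let $\Phi=\{\phi_n:n\in\mathbb N\}$ be an infinite autonomous conformal iterated function system on $X$, that is, a sequence of maps $\phi_n:X\to X$ with the following properties, where $\phi_w:=\phi_{w_1}\circ\dots\circ\phi_{w_k}$ for a finite word $w=w_1\dots w_k\in\mathbb N^k$: 1. (open set condition) $\phi_a(\operatorname{int}X)\cap\phi_b(\operatorname{int}X)=\emptyset$ for $a\neq b$; 2. (conformality) there is an open connected set $V\supset X$ such that every $\phi_n$ extends to a $C^1$ conformal diffeomorphism of $V$ into $V$ (orientation-reversing maps are allowed); 3. (bounded distortion) there is $K\ge1$ such that $\|D\phi_w(x)\|\le K\|D\phi_w(y)\|$ for all nonempty finite words $w$ and all $x,y\in V$; 4. (uniform contraction) there are $\eta\in[0,1)$ and $N\in\mathbb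 N$ such that $\|D\phi_w(x)\|\le\eta^m$ for all $m\ge N$, all words $w$ of length $m+1$ and all $x\in X$. Let $$J(\Phi)=\bigcap_{n\ge1}\ \bigcup_{w\in\mathbb N^n}\phi_w(X)$$ be the limit set of $\Phi$, and for $\omega\in\mathbb N^{\mathbb N}$ let $\pi_\Phi(\omega)$ be the point given by $\{\pi_\Phi(\omega)\}=\bigcap_{n\ge1}\phi_{\omega_1\dots\omega_n}(X)$. Let $\sigma:\mathbb N^{\mathbb N}\to\mathbb N^{\mathbb N}$, $\sigma(\omega)_n=\omega_{n+1}$, be the shift map, and, with the product topology on $\mathbb N^{\mathbb N}$, put $$I^\infty_{\mathrm{dense}}=\bigl\{\omega\in\mathbb N^{\mathbb N}:\overline{\{\sigma^n(\omega):n\ge0\}}=\mathbb N^{\mathbb N}\bigr\},\qquad J_{\mathrm{dense}}(\Phi)=\pi_\Phi\bigl(I^\infty_{\mathrm{dense}}\bigr).$$ Then the Hausdorff dimensions agree: $$\dim_H J_{\mathrm{dense}}(\Phi)=\dim_H J(\Phi).$$ -/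

import Mathlib

open Set

/-- `X ⊆ ℝᵈ` has `C¹` (in particular, possibly `C^∞`) boundary: near every boundary point, `X` is
the sublevel set `{f ≤ 0}` of a `C¹` function `f` whose derivative does not vanish there. -/
def HasC1Boundary {d : ℕ} (X : Set (EuclideanSpace ℝ (Fin d))) : Prop :=
  ∀ p ∈ frontier X, ∃ (U : Set (EuclideanSpace ℝ (Fin d))) (f : EuclideanSpace ℝ (Fin d) → ℝ),
    IsOpen U ∧ p ∈ U ∧ ContDiffOn ℝ 1 f U ∧ fderiv ℝ f p ≠ 0 ∧ X ∩ U = {x ∈ U | f x ≤ 0}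

/-- The cone condition: there are a half-angle `γ` and an altitude `l` such that every boundary
point of `X` is the vertex of an open cone of half-angle `γ` and altitude `l` (with some axis `u`)
contained in the interior of `X`. -/
def HasConeCondition {d : ℕ} (X : Set (EuclideanSpace ℝ (Fin d))) : Prop :=
  ∃ γ l : ℝ, 0 < γ ∧ γ < Real.pi / 2 ∧ 0 < l ∧
    ∀ x ∈ frontier X, ∃ u : EuclideanSpace ℝ (Fin d), ‖u‖ = 1 ∧
      {y | Real.cos γ * ‖y - x‖ < inner ℝ u (y - x) ∧ inner ℝ u (y - x) < l} ⊆ interior X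

/-- The composition `φ_{w₁} ∘ ⋯ ∘ φ_{wₙ}` attached to a finite word `w = w₁ ⋯ wₙ`. -/
def wordMap {I E : Type*} (φ : I → E → E) : List I → E → E
  | [] => id
  | i :: w => φ i ∘ wordMap φ w

/-- `(φ i)_{i ∈ I}` is an autonomous conformal iterated function system on `X ⊆ ℝᵈ`. Each `φ i` is
given as a function on all of `ℝᵈ`: on the neighbourhood `V` of `X` it is the conformal extension
of the map `X → X`, and its values outside `V` are irrelevant. -/
structure IsConformalIFS {d : ℕ} {I : Type*} (X : Set (EuclideanSpace ℝ (Fin d)))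
    (φ : I → EuclideanSpace ℝ (Fin d) → EuclideanSpace ℝ (Fin d)) : Prop where
  isCompact : IsCompact X
  closure_interior : closure (interior X) = X
  geometry : Convex ℝ X ∨ HasC1Boundary X ∨ HasConeCondition X
  mapsTo : ∀ i, MapsTo (φ i) X X
  /-- open set condition -/
  openSet : ∀ a b, a ≠ b → Disjoint (φ a '' interior X) (φ b '' interior X)
  /-- conformality and bounded distortion, on a common neighbourhood `V` of `X` -/
  conformal : ∃ V : Set (EuclideanSpace ℝ (Fin d)), IsOpen V ∧ IsConnected V ∧ X ⊆ V ∧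
    (∀ i, MapsTo (φ i) V V ∧ InjOn (φ i) V ∧ ContDiffOn ℝ 1 (φ i) V ∧
      ∀ x ∈ V, ConformalAt (φ i) x) ∧
    ∃ K : ℝ, 1 ≤ K ∧ ∀ w : List I, w ≠ [] → ∀ x ∈ V, ∀ y ∈ V,
      ‖fderiv ℝ (wordMap φ w) x‖ ≤ K * ‖fderiv ℝ (wordMap φ w) y‖
  /-- uniform contraction -/
  contraction : ∃ (η : ℝ) (N : ℕ), 0 ≤ η ∧ η < 1 ∧ ∀ m ≥ N, ∀ w : List I, w.length = m + 1 →
    ∀ x ∈ X, ‖fderiv ℝ (wordMap φ w) x‖ ≤ η ^ m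

/-- The limit set `J(Φ) = ⋂_{n ≥ 1} ⋃_{w ∈ Iⁿ} φ_w(X)`. -/
def limitSet {I E : Type*} (X : Set E) (φ : I → E → E) : Set E :=
  ⋂ (n : ℕ) (_ : 1 ≤ n), ⋃ (w : List I) (_ : w.length = n), wordMap φ w '' X

/-- `x` is the point `π_Φ(ω)` coded by `ω`, that is, `⋂_{n ≥ 1} φ_{ω|n}(X) = {x}`. -/
def IsCodedBy {I E : Type*} (X : Set E) (φ : I → E → E) (ω : ℕ → I) (x : E) : Prop :=
  ⋂ (n : ℕ) (_ : 1 ≤ n), wordMap φ ((List.range n).map ω) '' X = {x}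

/-- The shift map on sequences. -/
def shift {I : Type*} (ω : ℕ → I) : ℕ → I := fun n => ω (n + 1)

/-- The sequences whose forward orbit under the shift is dense in `ℕ^ℕ` (product topology). -/
def denseSequences : Set (ℕ → ℕ) := {ω | Dense (range fun n : ℕ => shift^[n] ω)}

/-- `J_dense(Φ) = π_Φ(I^∞_dense)`. -/
def denseLimitSet {E : Type*} (X : Set E) (φ : ℕ → E → E) : Set E :=
  {x | ∃ ω ∈ denseSequences, IsCodedBy X φ ω x}

/-!
The inequality `dimH J_dense ≤ dimH J` holds because `J_dense ⊆ J`. Conversely, let `0 ≤ s` with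
`μH[s] J = ∞`. Covering `J` by the sets `φ_w(X)` of one word length shows that some finite family
`F` of words of equal length has `∑ ‖Dφ_w‖ ^ s` as large as we please. Consider the sequences made
of freely chosen words of `F`, where after the `j`-th choice a fixed word `t j` is inserted and
every finite word occurs as some `t j`: the orbits of all of them under the shift are dense. The
long words are inserted so rarely that `t 0, …, t (j - 1)` together cost at most a factor `2 ^ j`.
Choosing the words of `F` independently with probabilities proportional to `‖Dφ_w‖ ^ s` therefore
gives every cylinder of `j` blocks a measure of at most `4 ^ (-j) ‖Dφ_w‖ ^ s`. By the open set
condition and bounded distortion, a volume count bounds the number of cylinders of `j + 1` blocks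
and size about `r` that meet a ball of radius `r` by a multiple of `2 ^ (j + 1)`. Summing over `j`,
the measure of the ball is at most a multiple of `r ^ s`, so `s ≤ dimH J_dense` by the mass
distribution principle.
-/

open Filter MeasureTheory Topology
open scoped ENNReal NNReal

section ConformalLinear

variable {E : Type*} [NormedAddCommGroup E] [InnerProductSpace ℝ E]

theorem norm_apply_of_isConformalMap [Nontrivial E] {A : E →L[ℝ] E} (hA : IsConformalMap A)
    (v : E) : ‖A v‖ = ‖A‖ * ‖v‖ := by
  obtain ⟨c, -, li, rfl⟩ := hA
  simp [norm_smul, LinearIsometry.norm_toContinuousLinearMap]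

theorem norm_comp_of_isConformalMap [Nontrivial E] {A B : E →L[ℝ] E} (hA : IsConformalMap A)
    (hB : IsConformalMap B) : ‖A.comp B‖ = ‖A‖ * ‖B‖ := by
  obtain ⟨v, hv⟩ := exists_ne (0 : E)
  refine mul_right_cancel₀ (norm_ne_zero_iff.2 hv) ?_
  rw [← norm_apply_of_isConformalMap (hA.comp hB), ContinuousLinearMap.comp_apply,
    norm_apply_of_isConformalMap hA, norm_apply_of_isConformalMap hB, mul_assoc]

theorem range_eq_top_of_isConformalMap [FiniteDimensional ℝ E] {A : E →L[ℝ] E}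
    (hA : IsConformalMap A) : A.range = ⊤ :=
  LinearMap.range_eq_top.2 (LinearMap.injective_iff_surjective.1 hA.injective)

theorem abs_det_of_isConformalMap [Nontrivial E] [FiniteDimensional ℝ E] {A : E →L[ℝ] E}
    (hA : IsConformalMap A) : |A.det| = ‖A‖ ^ Module.finrank ℝ E := by
  obtain ⟨c, -, li, rfl⟩ := hA
  have hli : |li.toContinuousLinearMap.det| = 1 := by
    rw [ContinuousLinearMap.det, ← LinearMap.normDet_eq_abs_det]
    exact li.normDet_eq_one
  rw [ContinuousLinearMap.det, ContinuousLinearMap.toLinearMap_smul, LinearMap.det_smul, abs_mul,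
    ← ContinuousLinearMap.det, hli, norm_smul, LinearIsometry.norm_toContinuousLinearMap, abs_pow,
    mul_one, mul_one, Real.norm_eq_abs]

end ConformalLinear

/-- The oscillation over `s` of every map `f i` is at most a fixed multiple of `c i`. For the word
maps of a system and `c` the norms of their derivatives at a point, this says that all the images
of `s` have diameter comparable to the derivative. -/
def OscillationBoundedOn {ι α β : Type*} [PseudoMetricSpace β] (f : ι → α → β) (c : ι → ℝ)
    (s : Set α) : Prop :=
  ∃ L : ℝ, ∀ i, ∀ x ∈ s, ∀ y ∈ s, dist (f i x) (f i y) ≤ L * c i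

namespace OscillationBoundedOn

section Pseudometric

variable {ι α β : Type*} [PseudoMetricSpace β] {f : ι → α → β} {c : ι → ℝ} {s t : Set α}

theorem mono (hs : OscillationBoundedOn f c s) (hts : t ⊆ s) : OscillationBoundedOn f c t :=
  hs.imp fun _ hL i x hx y hy => hL i x (hts hx) y (hts hy)

theorem singleton (f : ι → α → β) (c : ι → ℝ) (x : α) : OscillationBoundedOn f c {x} := by
  refine ⟨0, ?_⟩
  rintro i _ rfl _ rfl
  simp

theorem union (hs : OscillationBoundedOn f c s) (ht : OscillationBoundedOn f c t)
    (hst : (s ∩ t).Nonempty) : OscillationBoundedOn f c (s ∪ t) := by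
  obtain ⟨L, hL⟩ := hs
  obtain ⟨M, hM⟩ := ht
  obtain ⟨z, hzs, hzt⟩ := hst
  refine ⟨L + M, fun i => ?_⟩
  have hLi : 0 ≤ L * c i := dist_nonneg.trans (hL i z hzs z hzs)
  have hMi : 0 ≤ M * c i := dist_nonneg.trans (hM i z hzt z hzt)
  rw [add_mul]
  rintro x (hx | hx) y (hy | hy)
  · linarith [hL i x hx y hy]
  · linarith [dist_triangle (f i x) (f i z) (f i y), hL i x hx z hzs, hM i z hzt y hy]
  · linarith [dist_triangle (f i x) (f i z) (f i y), hM i x hx z hzt, hL i z hzs y hy]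
  · linarith [hM i x hx y hy]

end Pseudometric

section Differentiable

variable {ι E F : Type*} [NormedAddCommGroup E] [NormedSpace ℝ E] [NormedAddCommGroup F]
  [NormedSpace ℝ F] {f : ι → E → F} {c : ι → ℝ} {V : Set E}

theorem ball (x : E) (r : ℝ) (hf : ∀ i, ∀ y ∈ Metric.ball x r, DifferentiableAt ℝ (f i) y)
    (hbound : ∀ i, ∀ y ∈ Metric.ball x r, ‖fderiv ℝ (f i) y‖ ≤ c i) :
    OscillationBoundedOn f c (Metric.ball x r) := by
  refine ⟨r + r, fun i y hy z hz => ?_⟩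
  have hc : 0 ≤ c i := (norm_nonneg _).trans (hbound i y hy)
  calc dist (f i y) (f i z) = ‖f i y - f i z‖ := dist_eq_norm _ _
    _ ≤ c i * ‖y - z‖ :=
      (convex_ball x r).norm_image_sub_le_of_norm_fderiv_le (hf i) (hbound i) hz hy
    _ ≤ c i * (r + r) := by
      gcongr
      rw [← dist_eq_norm]
      linarith [dist_triangle_right y z x, Metric.mem_ball.1 hy, Metric.mem_ball.1 hz]
    _ = (r + r) * c i := mul_comm _ _

theorem exists_ball (hV : IsOpen V) (hf : ∀ i, ∀ y ∈ V, DifferentiableAt ℝ (f i) y)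
    (hbound : ∀ i, ∀ y ∈ V, ‖fderiv ℝ (f i) y‖ ≤ c i) {x : E} (hx : x ∈ V) :
    ∃ r > 0, OscillationBoundedOn f c (Metric.ball x r) := by
  obtain ⟨r, hr, hrV⟩ := Metric.isOpen_iff.1 hV x hx
  exact ⟨r, hr, ball x r (fun i y hy => hf i y (hrV hy)) fun i y hy => hbound i y (hrV hy)⟩

theorem pair (hV : IsOpen V) (hVc : IsPreconnected V)
    (hf : ∀ i, ∀ y ∈ V, DifferentiableAt ℝ (f i) y)
    (hbound : ∀ i, ∀ y ∈ V, ‖fderiv ℝ (f i) y‖ ≤ c i) {x y : E} (hx : x ∈ V) (hy : y ∈ V) :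
    OscillationBoundedOn f c {x, y} := by
  refine hVc.induction₂ (fun x y => OscillationBoundedOn f c {x, y}) ?_ ?_ ?_ hx hy
  · intro a ha
    obtain ⟨r, hr, hball⟩ := exists_ball hV hf hbound ha
    filter_upwards [mem_nhdsWithin_of_mem_nhds (Metric.ball_mem_nhds a hr)] with b hb
    exact hball.mono (pair_subset (Metric.mem_ball_self hr) hb)
  · intro a b e _ _ _ hab hbe
    exact (hab.union hbe ⟨b, by simp⟩).mono (by grind)
  · intro a b _ _ hab
    rwa [pair_comm]

theorem of_norm_fderiv_le (hV : IsOpen V) (hVc : IsPreconnected V)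
    (hf : ∀ i, ∀ y ∈ V, DifferentiableAt ℝ (f i) y)
    (hbound : ∀ i, ∀ y ∈ V, ‖fderiv ℝ (f i) y‖ ≤ c i) {X : Set E} (hX : IsCompact X)
    (hXV : X ⊆ V) : OscillationBoundedOn f c X := by
  obtain rfl | ⟨x₀, hx₀⟩ := X.eq_empty_or_nonempty
  · exact ⟨0, by simp⟩
  refine mono (s := insert x₀ X) ?_ (subset_insert _ _)
  refine hX.induction_on (p := fun s => OscillationBoundedOn f c (insert x₀ s)) ?_ ?_ ?_ ?_
  · rw [insert_empty_eq]
    exact singleton f c x₀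
  · exact fun s t hst ht => ht.mono (insert_subset_insert hst)
  · exact fun s t hs ht => (hs.union ht ⟨x₀, by simp⟩).mono (by grind)
  · intro x hx
    obtain ⟨r, hr, hball⟩ := exists_ball hV hf hbound (hXV hx)
    refine ⟨_, mem_nhdsWithin_of_mem_nhds (Metric.ball_mem_nhds x hr), ?_⟩
    have hpair := pair hV hVc hf hbound (hXV hx₀) (hXV hx)
    exact (hpair.union hball ⟨x, by simp [hr]⟩).mono (by grind)

end Differentiable

end OscillationBoundedOn

section WordMap

variable {I E : Type*} {φ : I → E → E} {s : Set E}

theorem wordMap_append (φ : I → E → E) (v w : List I) :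
    wordMap φ (v ++ w) = wordMap φ v ∘ wordMap φ w := by
  induction v with
  | nil => rfl
  | cons a v ih => simp only [List.cons_append, wordMap, ih, Function.comp_assoc]

theorem mapsTo_wordMap (hs : ∀ i, MapsTo (φ i) s s) (w : List I) : MapsTo (wordMap φ w) s s := by
  induction w with
  | nil => exact mapsTo_id s
  | cons a w ih => exact (hs a).comp ih

theorem injOn_wordMap (hs : ∀ i, MapsTo (φ i) s s) (hi : ∀ i, InjOn (φ i) s) (w : List I) :
    InjOn (wordMap φ w) s := by
  induction w with
  | nil => exact injOn_id s
  | cons a w ih => exact (hi a).comp ih (mapsTo_wordMap hs w)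

end WordMap

/-- The scale `‖Dφ_w(x)‖` of the word `w`, seen from the base point `x`. -/
noncomputable def wordScale {I E : Type*} [NormedAddCommGroup E] [NormedSpace ℝ E]
    (φ : I → E → E) (x : E) (w : List I) : ℝ :=
  ‖fderiv ℝ (wordMap φ w) x‖

theorem wordScale_nil {I E : Type*} [NormedAddCommGroup E] [NormedSpace ℝ E] [Nontrivial E]
    (φ : I → E → E) (x : E) : wordScale φ x [] = 1 := by
  simp only [wordScale, wordMap, fderiv_id, ContinuousLinearMap.norm_id]

/-- A conformal iterated function system on the compact set `X` of an inner product space, together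
with the neighbourhood `V` on which its maps are conformal and the distortion constant `K`.
Contraction means that the scales of long words tend to zero, at no prescribed rate. -/
structure IsConformalSystem {I E : Type*} [NormedAddCommGroup E] [InnerProductSpace ℝ E]
    (X V : Set E) (φ : I → E → E) (K : ℝ) : Prop where
  isCompact : IsCompact X
  isOpen : IsOpen V
  isPreconnected : IsPreconnected V
  subset : X ⊆ V
  mapsTo_X : ∀ i, MapsTo (φ i) X X
  mapsTo : ∀ i, MapsTo (φ i) V V
  injOn : ∀ i, InjOn (φ i) V
  contDiffOn : ∀ i, ContDiffOn ℝ 1 (φ i) V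
  conformalAt : ∀ i, ∀ x ∈ V, ConformalAt (φ i) x
  disjoint : ∀ a b, a ≠ b → Disjoint (φ a '' interior X) (φ b '' interior X)
  one_le : 1 ≤ K
  distortion : ∀ w, ∀ x ∈ V, ∀ y ∈ V, wordScale φ x w ≤ K * wordScale φ y w
  tendsto_wordScale : ∀ x ∈ X, Tendsto (wordScale φ x) (comap List.length atTop) (𝓝 0)

namespace IsConformalSystem

section InnerProductSpace

variable {I E : Type*} [NormedAddCommGroup E] [InnerProductSpace ℝ E]
  {X V : Set E} {φ : I → E → E} {K : ℝ}

theorem word_mapsTo (h : IsConformalSystem X V φ K) (w : List I) : MapsTo (wordMap φ w) V V :=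
  mapsTo_wordMap h.mapsTo w

theorem word_mapsTo_X (h : IsConformalSystem X V φ K) (w : List I) : MapsTo (wordMap φ w) X X :=
  mapsTo_wordMap h.mapsTo_X w

theorem word_injOn (h : IsConformalSystem X V φ K) (w : List I) : InjOn (wordMap φ w) V :=
  injOn_wordMap h.mapsTo h.injOn w

theorem word_contDiffOn (h : IsConformalSystem X V φ K) (w : List I) :
    ContDiffOn ℝ 1 (wordMap φ w) V := by
  induction w with
  | nil => exact contDiffOn_id
  | cons a w ih => exact (h.contDiffOn a).comp ih (h.word_mapsTo w)

theorem word_contDiffAt (h : IsConformalSystem X V φ K) (w : List I) {x : E} (hx : x ∈ V) :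
    ContDiffAt ℝ 1 (wordMap φ w) x :=
  (h.word_contDiffOn w).contDiffAt (h.isOpen.mem_nhds hx)

theorem word_differentiableAt (h : IsConformalSystem X V φ K) (w : List I) {x : E} (hx : x ∈ V) :
    DifferentiableAt ℝ (wordMap φ w) x :=
  (h.word_contDiffAt w hx).differentiableAt one_ne_zero

theorem word_conformalAt (h : IsConformalSystem X V φ K) (w : List I) {x : E} (hx : x ∈ V) :
    ConformalAt (wordMap φ w) x := by
  induction w with
  | nil => exact conformalAt_id x
  | cons a w ih => exact (h.conformalAt a _ (h.word_mapsTo w hx)).comp x ih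

theorem isConformalMap_fderiv (h : IsConformalSystem X V φ K) (w : List I) {x : E} (hx : x ∈ V) :
    IsConformalMap (fderiv ℝ (wordMap φ w) x) :=
  conformalAt_iff_isConformalMap_fderiv.1 (h.word_conformalAt w hx)

theorem wordScale_append [Nontrivial E] (h : IsConformalSystem X V φ K) (v w : List I) {x : E}
    (hx : x ∈ V) :
    wordScale φ x (v ++ w) = wordScale φ (wordMap φ w x) v * wordScale φ x w := by
  have hwx := h.word_mapsTo w hx
  rw [wordScale, wordMap_append,
    fderiv_comp x (h.word_differentiableAt v hwx) (h.word_differentiableAt w hx)]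
  exact norm_comp_of_isConformalMap (h.isConformalMap_fderiv v hwx) (h.isConformalMap_fderiv w hx)

theorem isCompact_word_image (h : IsConformalSystem X V φ K) (w : List I) :
    IsCompact (wordMap φ w '' X) :=
  h.isCompact.image_of_continuousOn ((h.word_contDiffOn w).continuousOn.mono h.subset)

theorem exists_dist_le (h : IsConformalSystem X V φ K) {x₀ : E} (hx₀ : x₀ ∈ X) :
    ∃ C : ℝ, 0 ≤ C ∧
      ∀ w, ∀ x ∈ X, ∀ y ∈ X, dist (wordMap φ w x) (wordMap φ w y) ≤ C * wordScale φ x₀ w := by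
  obtain ⟨L, hL⟩ := OscillationBoundedOn.of_norm_fderiv_le h.isOpen h.isPreconnected
    (fun w _ => h.word_differentiableAt w) (fun w x hx => h.distortion w x hx x₀ (h.subset hx₀))
    h.isCompact h.subset
  refine ⟨|L| * K, mul_nonneg (abs_nonneg L) (zero_le_one.trans h.one_le), fun w x hx y hy => ?_⟩
  have hKw : 0 ≤ K * wordScale φ x₀ w :=
    mul_nonneg (zero_le_one.trans h.one_le) (norm_nonneg _)
  calc dist (wordMap φ w x) (wordMap φ w y) ≤ L * (K * wordScale φ x₀ w) := hL w x hx y hy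
    _ ≤ |L| * (K * wordScale φ x₀ w) := by
      gcongr
      exact le_abs_self L
    _ = |L| * K * wordScale φ x₀ w := (mul_assoc _ _ _).symm

end InnerProductSpace

section FiniteDimensional

variable {I E : Type*} [NormedAddCommGroup E] [InnerProductSpace ℝ E] [FiniteDimensional ℝ E]
  {X V : Set E} {φ : I → E → E} {K : ℝ}

theorem word_mapsTo_interior (h : IsConformalSystem X V φ K) (w : List I) :
    MapsTo (wordMap φ w) (interior X) (interior X) := by
  intro x hx
  have hxV := h.subset (interior_subset hx)
  have hmap := ((h.word_contDiffAt w hxV).hasStrictFDerivAt one_ne_zero).map_nhds_eq_of_surj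
    (range_eq_top_of_isConformalMap (h.isConformalMap_fderiv w hxV))
  rw [mem_interior_iff_mem_nhds, ← hmap, mem_map]
  filter_upwards [mem_interior_iff_mem_nhds.1 hx] with y hy
  exact h.word_mapsTo_X w hy

theorem disjoint_word_image (h : IsConformalSystem X V φ K) {v w : List I}
    (hlen : v.length = w.length) (hvw : v ≠ w) :
    Disjoint (wordMap φ v '' interior X) (wordMap φ w '' interior X) := by
  induction v generalizing w with
  | nil => exact absurd (List.length_eq_zero_iff.1 hlen.symm).symm hvw
  | cons a v ih =>
    obtain ⟨b, w, rfl⟩ := List.exists_cons_of_length_eq_add_one hlen.symm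
    have hint : ∀ u, wordMap φ u '' interior X ⊆ interior X :=
      fun u => (h.word_mapsTo_interior u).image_subset
    simp only [wordMap, image_comp]
    obtain rfl | hab := eq_or_ne a b
    · have hV : ∀ u, wordMap φ u '' interior X ⊆ V :=
        fun u => (hint u).trans (interior_subset.trans h.subset)
      have hdisj := ih (by simpa using hlen) (by simpa using hvw)
      exact hdisj.image (h.injOn a) (hV v) (hV w)
    · exact (h.disjoint a b hab).mono (image_mono (hint v)) (image_mono (hint w))

variable [MeasurableSpace E] [BorelSpace E]

theorem measurableSet_word_image (h : IsConformalSystem X V φ K) (w : List I) :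
    MeasurableSet (wordMap φ w '' interior X) :=
  have hsub : interior X ⊆ V := interior_subset.trans h.subset
  measurable_image_of_fderivWithin isOpen_interior.measurableSet
    (fun _ hx => (h.word_differentiableAt w (hsub hx)).hasFDerivAt.hasFDerivWithinAt)
    ((h.word_injOn w).mono hsub)

variable [Nontrivial E] (μ : Measure E) [μ.IsAddHaarMeasure]

theorem le_addHaar_word_image (h : IsConformalSystem X V φ K) (w : List I) {x₀ : E}
    (hx₀ : x₀ ∈ V) :
    ENNReal.ofReal ((wordScale φ x₀ w / K) ^ Module.finrank ℝ E) * μ (interior X) ≤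
      μ (wordMap φ w '' interior X) := by
  have hsub : interior X ⊆ V := interior_subset.trans h.subset
  rw [← lintegral_abs_det_fderiv_eq_addHaar_image μ isOpen_interior.measurableSet
    (fun x hx => (h.word_differentiableAt w (hsub hx)).hasFDerivAt.hasFDerivWithinAt)
    ((h.word_injOn w).mono hsub), ← setLIntegral_const]
  refine setLIntegral_mono' isOpen_interior.measurableSet fun x hx => ?_
  rw [abs_det_of_isConformalMap (h.isConformalMap_fderiv w (hsub hx))]
  have hK : 0 < K := one_pos.trans_le h.one_le
  have hscale : 0 ≤ wordScale φ x₀ w := norm_nonneg _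
  gcongr
  exact (div_le_iff₀' hK).2 (h.distortion w x₀ hx₀ x (hsub hx))

theorem card_mul_le_addHaar_closedBall (h : IsConformalSystem X V φ K) {x₀ : E} (hx₀ : x₀ ∈ V)
    {T : Finset (List I)} {m : ℕ} (hlen : ∀ w ∈ T, w.length = m) {ε : ℝ} (hε : 0 ≤ ε)
    (hscale : ∀ w ∈ T, ε ≤ wordScale φ x₀ w) {x : E} {R : ℝ}
    (hsub : ∀ w ∈ T, wordMap φ w '' interior X ⊆ Metric.closedBall x R) :
    T.card * (ENNReal.ofReal ((ε / K) ^ Module.finrank ℝ E) * μ (interior X)) ≤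
      μ (Metric.closedBall x R) := by
  have hK : 0 ≤ K := zero_le_one.trans h.one_le
  calc T.card * (ENNReal.ofReal ((ε / K) ^ Module.finrank ℝ E) * μ (interior X))
      ≤ ∑ w ∈ T, μ (wordMap φ w '' interior X) := by
        rw [← nsmul_eq_mul]
        refine Finset.card_nsmul_le_sum _ _ _ fun w hw => ?_
        refine le_trans ?_ (h.le_addHaar_word_image μ w hx₀)
        gcongr
        exact hscale w hw
    _ = μ (⋃ w ∈ T, wordMap φ w '' interior X) := by
        refine (measure_biUnion_finset (fun v hv w hw hvw => ?_) fun w _ =>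
          h.measurableSet_word_image w).symm
        exact h.disjoint_word_image ((hlen v hv).trans (hlen w hw).symm) hvw
    _ ≤ μ (Metric.closedBall x R) := measure_mono (iUnion₂_subset hsub)

end FiniteDimensional

variable {I E : Type*} [NormedAddCommGroup E] [InnerProductSpace ℝ E] [FiniteDimensional ℝ E]
  [Nontrivial E] {X V : Set E} {φ : I → E → E} {K : ℝ}

theorem exists_card_mul_pow_le (h : IsConformalSystem X V φ K) {x₀ : E} (hx₀ : x₀ ∈ interior X) :
    ∃ M : ℝ, 0 ≤ M ∧ ∀ (T : Finset (List I)) (m : ℕ) (x : E) (ε r : ℝ), 0 ≤ ε → 0 ≤ r →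
      (∀ w ∈ T, w.length = m) → (∀ w ∈ T, wordScale φ x₀ w ∈ Icc ε r) →
      (∀ w ∈ T, (wordMap φ w '' X ∩ Metric.closedBall x r).Nonempty) →
      T.card * ε ^ Module.finrank ℝ E ≤ M * r ^ Module.finrank ℝ E := by
  borelize E
  have hx₀X := interior_subset hx₀
  obtain ⟨C, hC, hdist⟩ := h.exists_dist_le hx₀X
  let μ : Measure E := Measure.addHaar
  set d := Module.finrank ℝ E
  set b := μ.real (Metric.closedBall 0 1)
  set v := μ.real (interior X)
  have hK : 0 < K := one_pos.trans_le h.one_le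
  have hv : 0 < v := ENNReal.toReal_pos (isOpen_interior.measure_pos μ ⟨x₀, hx₀⟩).ne'
    ((measure_mono interior_subset).trans_lt h.isCompact.measure_lt_top).ne
  refine ⟨(1 + C) ^ d * b * K ^ d / v, by positivity, fun T m x ε r hε hr hlen hscale hT => ?_⟩
  have hsub : ∀ w ∈ T, wordMap φ w '' interior X ⊆ Metric.closedBall x ((1 + C) * r) := by
    rintro w hw _ ⟨y, hy, rfl⟩
    obtain ⟨_, ⟨z, hz, rfl⟩, hzx⟩ := hT w hw
    calc dist (wordMap φ w y) x ≤ dist (wordMap φ w y) (wordMap φ w z) + dist (wordMap φ w z) x :=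
          dist_triangle _ _ _
      _ ≤ C * r + r := add_le_add ((hdist w y (interior_subset hy) z hz).trans
          (mul_le_mul_of_nonneg_left (hscale w hw).2 hC)) hzx
      _ = (1 + C) * r := by ring
  have hvol : T.card * ((ε / K) ^ d * v) ≤ ((1 + C) * r) ^ d * b := by
    have hvol' := ENNReal.toReal_mono measure_closedBall_lt_top.ne
      (h.card_mul_le_addHaar_closedBall μ (h.subset hx₀X) hlen hε (fun w hw => (hscale w hw).1)
        hsub)
    rw [Measure.addHaar_closedBall' μ x (by positivity), ENNReal.toReal_mul, ENNReal.toReal_mul,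
      ENNReal.toReal_mul, ENNReal.toReal_natCast, ENNReal.toReal_ofReal (by positivity),
      ENNReal.toReal_ofReal (by positivity)] at hvol'
    exact hvol'
  calc T.card * ε ^ d = T.card * ((ε / K) ^ d * v) * (K ^ d / v) := by
        rw [div_pow]
        field_simp
    _ ≤ ((1 + C) * r) ^ d * b * (K ^ d / v) := by gcongr
    _ = (1 + C) ^ d * b * K ^ d / v * r ^ d := by
        rw [mul_pow]
        ring

end IsConformalSystem

section Concatenation

variable {I : Type*}

/-- The word `b₀ b₁ ⋯ bⱼ₋₁`. -/
def prefixConcat (b : ℕ → List I) (j : ℕ) : List I :=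
  (List.range j).flatMap b

/-- The infinite sequence `b₀ b₁ b₂ ⋯`. The default value is never attained if no block is empty,
since then the first `k + 1` blocks have at least `k + 1` letters. -/
def concatSeq [Inhabited I] (b : ℕ → List I) (k : ℕ) : I :=
  (prefixConcat b (k + 1)).getD k default

theorem prefixConcat_succ (b : ℕ → List I) (j : ℕ) :
    prefixConcat b (j + 1) = prefixConcat b j ++ b j := by
  simp [prefixConcat, List.range_succ]

theorem prefixConcat_prefix (b : ℕ → List I) {i j : ℕ} (hij : i ≤ j) :
    prefixConcat b i <+: prefixConcat b j := by
  induction j, hij using Nat.le_induction with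
  | base => exact List.prefix_rfl
  | succ j _ ih => exact ih.trans (prefixConcat_succ b j ▸ List.prefix_append _ _)

theorem le_length_prefixConcat {b : ℕ → List I} (hb : ∀ j, b j ≠ []) (j : ℕ) :
    j ≤ (prefixConcat b j).length := by
  induction j with
  | zero => exact Nat.zero_le _
  | succ j ih =>
    rw [prefixConcat_succ, List.length_append]
    exact Nat.add_le_add ih (List.length_pos_iff.2 (hb j))

variable [Inhabited I]

theorem concatSeq_eq_getElem {b : ℕ → List I} (hb : ∀ j, b j ≠ []) {j k : ℕ}
    (hk : k < (prefixConcat b j).length) : concatSeq b k = (prefixConcat b j)[k] := by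
  have hk' : k < (prefixConcat b (k + 1)).length := le_length_prefixConcat hb (k + 1)
  rw [concatSeq, List.getD_eq_getElem _ _ hk']
  rcases le_total (k + 1) j with h | h
  · exact (prefixConcat_prefix b h).getElem hk'
  · exact ((prefixConcat_prefix b h).getElem hk).symm

theorem map_range_concatSeq {b : ℕ → List I} (hb : ∀ j, b j ≠ []) (j : ℕ) :
    (List.range (prefixConcat b j).length).map (concatSeq b) = prefixConcat b j :=
  List.ext_getElem (by simp) fun k _ hk => by
    rw [List.getElem_map, List.getElem_range, concatSeq_eq_getElem hb hk]

end Concatenation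

section DenseSequences

theorem shift_iterate_apply {I : Type*} (ω : ℕ → I) (n k : ℕ) : shift^[n] ω k = ω (n + k) := by
  induction n generalizing ω with
  | zero => simp
  | succ n ih => rw [Function.iterate_succ_apply, ih, shift, Nat.add_right_comm]

theorem mem_denseSequences_of_forall_exists {ω : ℕ → ℕ}
    (hω : ∀ w : List ℕ, ∃ n, ∀ i (hi : i < w.length), ω (n + i) = w[i]) :
    ω ∈ denseSequences := by
  intro x
  refine mem_closure_iff.2 fun o ho hxo => ?_
  obtain ⟨_, ⟨y, m, rfl⟩, -, hyo⟩ :=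
    (PiNat.isTopologicalBasis_cylinders fun _ : ℕ => ℕ).exists_subset_of_mem_open hxo ho
  obtain ⟨n, hn⟩ := hω ((List.range m).map y)
  refine ⟨_, hyo fun i hi => ?_, ⟨n, rfl⟩⟩
  change shift^[n] ω i = y i
  rw [shift_iterate_apply, hn i (by simpa using hi), List.getElem_map, List.getElem_range]

theorem concatSeq_mem_denseSequences {b : ℕ → List ℕ} (hb : ∀ j, b j ≠ [])
    (hw : ∀ w, ∃ j, w <:+ b j) : concatSeq b ∈ denseSequences := by
  refine mem_denseSequences_of_forall_exists fun w => ?_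
  obtain ⟨j, v, hv⟩ := hw w
  refine ⟨(prefixConcat b j ++ v).length, fun i hi => ?_⟩
  have hsucc : prefixConcat b (j + 1) = (prefixConcat b j ++ v) ++ w := by
    rw [prefixConcat_succ, ← hv, List.append_assoc]
  rw [concatSeq_eq_getElem hb (j := j + 1) (by simpa [hsucc, Nat.add_assoc] using hi)]
  simp only [hsucc]
  rw [List.getElem_append_right (Nat.le_add_right _ _)]
  simp only [Nat.add_sub_cancel_left]

end DenseSequences

section SplicedWord

variable {A I : Type*}

/-- The word `ι(c₀) t₀ ι(c₁) t₁ ⋯ ι(cⱼ₋₁) tⱼ₋₁`, in which the blocks `ι(cᵢ)` are chosen freely from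
the words `ι a`, while the words `tᵢ` are the same for every choice. -/
def splicedWord (ι : A → List I) (t : ℕ → List I) (c : ℕ → A) : ℕ → List I :=
  prefixConcat fun i => ι (c i) ++ t i

theorem splicedWord_succ (ι : A → List I) (t : ℕ → List I) (c : ℕ → A) (j : ℕ) :
    splicedWord ι t c (j + 1) = splicedWord ι t c j ++ (ι (c j) ++ t j) :=
  prefixConcat_succ _ j

theorem length_splicedWord_congr {ι : A → List I} {n : ℕ} (hι : ∀ a, (ι a).length = n)
    (t : ℕ → List I) (c c' : ℕ → A) (j : ℕ) :
    (splicedWord ι t c j).length = (splicedWord ι t c' j).length := by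
  induction j with
  | zero => rfl
  | succ j ih => simp only [splicedWord_succ, List.length_append, ih, hι]

theorem mem_cylinder_of_splicedWord_eq {ι : A → List I} (hinj : Function.Injective ι) {n : ℕ}
    (hι : ∀ a, (ι a).length = n) {t : ℕ → List I} {c c' : ℕ → A} {j : ℕ}
    (h : splicedWord ι t c' j = splicedWord ι t c j) : c' ∈ PiNat.cylinder c j := by
  induction j with
  | zero => simp
  | succ j ih =>
    rw [splicedWord_succ, splicedWord_succ] at h
    obtain ⟨hinit, hlast⟩ := List.append_inj h (length_splicedWord_congr hι t c' c j)
    intro i hi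
    obtain hij | rfl := Nat.lt_succ_iff_lt_or_eq.1 hi
    · exact ih hinit i hij
    · exact hinj (List.append_inj hlast ((hι _).trans (hι _).symm)).1

theorem finite_range_splicedWord [Finite A] (ι : A → List I) (t : ℕ → List I) (j : ℕ) :
    (range fun c => splicedWord ι t c j).Finite := by
  induction j with
  | zero => exact (finite_singleton []).subset (by
      rintro _ ⟨c, rfl⟩
      rfl)
  | succ j ih =>
    refine (ih.image2 (fun v w => v ++ (w ++ t j)) (finite_range ι)).subset ?_
    rintro _ ⟨c, rfl⟩
    exact ⟨_, ⟨c, rfl⟩, _, ⟨c j, rfl⟩, (splicedWord_succ ι t c j).symm⟩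

theorem measurable_apply_splicedWord [Countable I] [Countable A] [MeasurableSpace A]
    [MeasurableSingletonClass A] {E : Type*} [MeasurableSpace E] (g : List I → E)
    (ι : A → List I) (t : ℕ → List I) (j : ℕ) :
    Measurable fun c : ℕ → A => g (splicedWord ι t c j) := by
  let _ : MeasurableSpace (List I) := ⊤
  have : DiscreteMeasurableSpace (List I) := ⟨fun _ => trivial⟩
  suffices Measurable fun c : ℕ → A => splicedWord ι t c j from Measurable.of_discrete.comp this
  induction j with
  | zero => exact measurable_const
  | succ j ih =>
    simp only [splicedWord_succ]
    have happend : Measurable fun p : List I × A => p.1 ++ (ι p.2 ++ t j) := Measurable.of_discrete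
    exact happend.comp (ih.prodMk (measurable_pi_apply j))

end SplicedWord

/-- A positive weight on words that is supermultiplicative up to the constant `K`. The scales of a
conformal system have this property by bounded distortion, and so do their powers. -/
structure IsQuasiMultiplicative {I : Type*} (ρ : List I → ℝ) (K : ℝ) : Prop where
  pos : ∀ w, 0 < ρ w
  nil : ρ [] = 1
  mul_le : ∀ v w, ρ v * ρ w ≤ K * ρ (v ++ w)

theorem IsConformalSystem.isQuasiMultiplicative_wordScale {I E : Type*} [NormedAddCommGroup E]
    [InnerProductSpace ℝ E] [Nontrivial E] {X V : Set E} {φ : I → E → E} {K : ℝ}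
    (h : IsConformalSystem X V φ K) {x : E} (hx : x ∈ V) :
    IsQuasiMultiplicative (wordScale φ x) K where
  pos w := norm_pos_iff.2 (h.isConformalMap_fderiv w hx).ne_zero
  nil := wordScale_nil φ x
  mul_le v w := by
    rw [h.wordScale_append v w hx, ← mul_assoc]
    exact mul_le_mul_of_nonneg_right (h.distortion v x hx _ (h.word_mapsTo w hx)) (norm_nonneg _)

namespace IsQuasiMultiplicative

variable {A I : Type*} {ρ : List I → ℝ} {K : ℝ}

theorem one_le (hρ : IsQuasiMultiplicative ρ K) : 1 ≤ K := by
  simpa [hρ.nil] using hρ.mul_le [] []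

theorem rpow (hρ : IsQuasiMultiplicative ρ K) {s : ℝ} (hs : 0 ≤ s) :
    IsQuasiMultiplicative (fun w => ρ w ^ s) (K ^ s) where
  pos w := Real.rpow_pos_of_pos (hρ.pos w) s
  nil := by rw [hρ.nil, Real.one_rpow]
  mul_le v w := by
    rw [← Real.mul_rpow (hρ.pos v).le (hρ.pos w).le,
      ← Real.mul_rpow (zero_le_one.trans hρ.one_le) (hρ.pos _).le]
    exact Real.rpow_le_rpow (mul_pos (hρ.pos v) (hρ.pos w)).le (hρ.mul_le v w) hs

theorem mul_mul_le (hρ : IsQuasiMultiplicative ρ K) (u v w : List I) :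
    ρ u * (ρ v * ρ w) ≤ K ^ 2 * ρ (u ++ (v ++ w)) :=
  calc ρ u * (ρ v * ρ w) ≤ ρ u * (K * ρ (v ++ w)) :=
        mul_le_mul_of_nonneg_left (hρ.mul_le v w) (hρ.pos u).le
    _ = K * (ρ u * ρ (v ++ w)) := by ring
    _ ≤ K * (K * ρ (u ++ (v ++ w))) :=
        mul_le_mul_of_nonneg_left (hρ.mul_le u _) (zero_le_one.trans hρ.one_le)
    _ = K ^ 2 * ρ (u ++ (v ++ w)) := by ring

theorem prod_mul_prod_le (hρ : IsQuasiMultiplicative ρ K) (ι : A → List I) (t : ℕ → List I)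
    (c : ℕ → A) (j : ℕ) :
    (∏ i ∈ Finset.range j, ρ (ι (c i))) * ∏ i ∈ Finset.range j, ρ (t i) ≤
      (K ^ 2) ^ j * ρ (splicedWord ι t c j) := by
  induction j with
  | zero => simp [splicedWord, prefixConcat, hρ.nil]
  | succ j ih =>
    rw [Finset.prod_range_succ, Finset.prod_range_succ, splicedWord_succ, pow_succ]
    have hblock : 0 ≤ ρ (ι (c j)) * ρ (t j) := (mul_pos (hρ.pos _) (hρ.pos _)).le
    linear_combination ρ (ι (c j)) * ρ (t j) * ih +
      (K ^ 2) ^ j * hρ.mul_mul_le (splicedWord ι t c j) (ι (c j)) (t j)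

end IsQuasiMultiplicative

section SlowEnumeration

variable {α : Type*} [Countable α] {f : α → ℝ} {e : α}

theorem exists_surjective_pow_le_prod (hpos : ∀ x, 0 < f x) (he : f e = 1) :
    ∃ t : ℕ → α, Function.Surjective t ∧
      ∀ j, (1 / 2 : ℝ) ^ j ≤ ∏ i ∈ Finset.range j, f (t i) := by
  have : Nonempty α := ⟨e⟩
  obtain ⟨u, hu⟩ := exists_surjective_nat α
  -- The `k`-th element is listed at a time `n k` so late that the first `k + 1` elements cost at
  -- most `2 ^ (n k)`; at all other times `t` takes the value `e`, which costs nothing.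
  have hsparse : ∀ k, ∀ᶠ n in atTop, (1 / 2 : ℝ) ^ n ≤ ∏ l ∈ Finset.range (k + 1), f (u l) :=
    fun k => (tendsto_pow_atTop_nhds_zero_of_lt_one (by norm_num) (by norm_num)).eventually_le_const
      (Finset.prod_pos fun l _ => hpos (u l))
  obtain ⟨n, hn, hnprod⟩ := extraction_forall_of_eventually hsparse
  let t : ℕ → α := Function.extend n u fun _ => e
  have htn : ∀ k, t (n k) = u k := hn.injective.extend_apply u _
  have hte : ∀ i ∉ range n, f (t i) = 1 := fun i hi => by
    rw [show t i = e from Function.extend_apply' u _ i hi, he]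
  refine ⟨t, fun x => (hu x).elim fun k hk => ⟨n k, (htn k).trans hk⟩, fun j => ?_⟩
  induction j with
  | zero => simp
  | succ j ih =>
    have hhalf : (1 / 2 : ℝ) ^ (j + 1) ≤ (1 / 2) ^ j :=
      pow_le_pow_of_le_one (by norm_num) (by norm_num) j.le_succ
    obtain ⟨k, rfl⟩ | hj := em (j ∈ range n)
    · have hprod : ∏ l ∈ Finset.range (k + 1), f (u l) =
          ∏ i ∈ Finset.range (n k + 1), f (t i) := by
        refine Finset.prod_of_injOn n hn.injective.injOn ?_ ?_ fun l _ => by rw [htn]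
        · intro l hl
          simpa [Nat.lt_succ_iff, hn.le_iff_le] using hl
        · rintro i hi hin
          refine hte i ?_
          rintro ⟨l, rfl⟩
          exact hin ⟨l, by simpa [Nat.lt_succ_iff, hn.le_iff_le] using hi, rfl⟩
      exact hhalf.trans (hprod ▸ hnprod k)
    · rw [Finset.prod_range_succ, hte j hj, mul_one]
      exact hhalf.trans ih

theorem exists_surjective_pow_le_prod_and_pow_le {g : α → ℝ} (hf : ∀ x, 0 < f x)
    (hg : ∀ x, 0 < g x) (hfe : f e = 1) (hge : g e = 1) :
    ∃ t : ℕ → α, Function.Surjective t ∧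
      (∀ j, (1 / 2 : ℝ) ^ j ≤ ∏ i ∈ Finset.range j, f (t i)) ∧
      ∀ j, (1 / 2 : ℝ) ^ (j + 1) ≤ g (t j) := by
  let m : α → ℝ := fun x => min 1 (min (f x) (g x))
  have hm : ∀ x, 0 < m x := fun x => lt_min one_pos (lt_min (hf x) (hg x))
  have hmf : ∀ x, m x ≤ f x := fun x => (min_le_right _ _).trans (min_le_left _ _)
  have hmg : ∀ x, m x ≤ g x := fun x => (min_le_right _ _).trans (min_le_right _ _)
  obtain ⟨t, ht, hprod⟩ := exists_surjective_pow_le_prod hm (e := e)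
    (by simp only [m, hfe, hge, min_self])
  refine ⟨t, ht, fun j => (hprod j).trans ?_, fun j => (hprod (j + 1)).trans ?_⟩
  · exact Finset.prod_le_prod (fun i _ => (hm _).le) fun i _ => hmf _
  · rw [Finset.prod_range_succ]
    refine (mul_le_of_le_one_left (hm _).le ?_).trans (hmg _)
    exact Finset.prod_le_one (fun i _ => (hm _).le) fun i _ => min_le_left _ _

end SlowEnumeration

section CylinderMeasure

variable {A I : Type*} [MeasurableSpace A] [MeasurableSingletonClass A]

theorem infinitePi_toMeasure_cylinder (P : PMF A) (c : ℕ → A) (j : ℕ) :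
    Measure.infinitePi (fun _ : ℕ => P.toMeasure) (PiNat.cylinder c j) =
      ∏ i ∈ Finset.range j, P (c i) := by
  rw [PiNat.cylinder_eq_pi, Measure.infinitePi_pi _ fun i _ => measurableSet_singleton _]
  exact Finset.prod_congr rfl fun i _ =>
    PMF.toMeasure_apply_singleton _ _ (measurableSet_singleton _)

theorem IsQuasiMultiplicative.exists_measure_splicedWord_le [Fintype A] {ρ : List I → ℝ} {K : ℝ}
    (hρ : IsQuasiMultiplicative ρ K) {ι : A → List I} (hinj : Function.Injective ι) {n : ℕ}
    (hι : ∀ a, (ι a).length = n) (hsum : 8 * K ^ 2 ≤ ∑ a, ρ (ι a)) {t : ℕ → List I}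
    (ht : ∀ j, (1 / 2 : ℝ) ^ j ≤ ∏ i ∈ Finset.range j, ρ (t i)) :
    ∃ μ : Measure (ℕ → A), IsProbabilityMeasure μ ∧
      ∀ w j, μ {c | splicedWord ι t c j = w} ≤ ENNReal.ofReal ((1 / 4) ^ j * ρ w) := by
  set Z := ∑ a, ρ (ι a)
  have hZ : 0 < Z := lt_of_lt_of_le (by have := hρ.one_le; positivity) hsum
  have hp : ∀ a, 0 ≤ ρ (ι a) / Z := fun a => div_nonneg (hρ.pos _).le hZ.le
  let P : PMF A := PMF.ofFintype (fun a => ENNReal.ofReal (ρ (ι a) / Z)) (by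
    rw [← ENNReal.ofReal_sum_of_nonneg fun a _ => hp a, ← Finset.sum_div, div_self hZ.ne',
      ENNReal.ofReal_one])
  refine ⟨Measure.infinitePi fun _ => P.toMeasure, inferInstance, fun w j => ?_⟩
  obtain ⟨c, rfl⟩ | hw := em (∃ c, splicedWord ι t c j = w)
  · refine (measure_mono fun c' hc' => mem_cylinder_of_splicedWord_eq hinj hι hc').trans ?_
    rw [infinitePi_toMeasure_cylinder]
    simp only [P, PMF.ofFintype_apply]
    rw [← ENNReal.ofReal_prod_of_nonneg fun i _ => hp (c i), Finset.prod_div_distrib,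
      Finset.prod_const, Finset.card_range]
    refine ENNReal.ofReal_le_ofReal ((div_le_iff₀ (pow_pos hZ j)).2 ?_)
    have hprod : 0 ≤ ∏ i ∈ Finset.range j, ρ (ι (c i)) :=
      Finset.prod_nonneg fun i _ => (hρ.pos _).le
    have hw := (hρ.pos (splicedWord ι t c j)).le
    calc ∏ i ∈ Finset.range j, ρ (ι (c i))
        = 2 ^ j * ((∏ i ∈ Finset.range j, ρ (ι (c i))) * (1 / 2) ^ j) := by
          rw [mul_left_comm, ← mul_pow]
          norm_num
      _ ≤ 2 ^ j * ((∏ i ∈ Finset.range j, ρ (ι (c i))) * ∏ i ∈ Finset.range j, ρ (t i)) := by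
          gcongr
          exact ht j
      _ ≤ 2 ^ j * ((K ^ 2) ^ j * ρ (splicedWord ι t c j)) := by
          exact mul_le_mul_of_nonneg_left (hρ.prod_mul_prod_le ι t c j) (by positivity)
      _ = (1 / 4) ^ j * ρ (splicedWord ι t c j) * (8 * K ^ 2) ^ j := by
          rw [show (8 : ℝ) * K ^ 2 = 4 * (2 * K ^ 2) by ring, mul_pow 4, mul_pow 2, one_div,
            inv_pow]
          field_simp
      _ ≤ (1 / 4) ^ j * ρ (splicedWord ι t c j) * Z ^ j := by gcongr
  · have hempty : {c | splicedWord ι t c j = w} = ∅ :=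
      eq_empty_of_forall_notMem fun c hc => hw ⟨c, hc⟩
    rw [hempty, measure_empty]
    exact zero_le

end CylinderMeasure

section MassDistribution

variable {E : Type*} [MetricSpace E] [MeasurableSpace E] {μ : Measure E} {s : ℝ≥0} {C : ℝ}

theorem measure_le_mul_ediam_rpow
    (hball : ∀ x r, 0 < r → r < 1 →
      μ (Metric.closedBall x r) ≤ ENNReal.ofReal (C * r ^ (s : ℝ)))
    {S : Set E} (hne : S.Nonempty) (hS : Metric.ediam S < 1) :
    μ S ≤ ENNReal.ofReal C * Metric.ediam S ^ (s : ℝ) := by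
  obtain ⟨x, hx⟩ := hne
  have hStop : Metric.ediam S ≠ ∞ := (hS.trans ENNReal.one_lt_top).ne
  have hdiam : Metric.diam S < 1 := ENNReal.toReal_lt_of_lt_ofReal (by simpa using hS)
  have hr : ∀ r ∈ Ioo (Metric.diam S) 1, μ S ≤ ENNReal.ofReal (C * r ^ (s : ℝ)) := by
    rintro r ⟨hSr, hr1⟩
    refine (measure_mono fun y hy => ?_).trans (hball x r (Metric.diam_nonneg.trans_lt hSr) hr1)
    exact (Metric.dist_le_diam_of_mem (Metric.isBounded_iff_ediam_ne_top.2 hStop) hy hx).trans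
      hSr.le
  have hlim : Tendsto (fun r : ℝ => ENNReal.ofReal (C * r ^ (s : ℝ))) (𝓝[>] Metric.diam S)
      (𝓝 (ENNReal.ofReal (C * Metric.diam S ^ (s : ℝ)))) :=
    (ENNReal.continuous_ofReal.comp
      ((Real.continuous_rpow_const s.coe_nonneg).const_mul C)).continuousWithinAt
  have hmeas : μ S ≤ ENNReal.ofReal (C * Metric.diam S ^ (s : ℝ)) :=
    ge_of_tendsto hlim (mem_of_superset (Ioo_mem_nhdsGT hdiam) hr)
  rwa [ENNReal.ofReal_mul' (Real.rpow_nonneg Metric.diam_nonneg _),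
    ← ENNReal.ofReal_rpow_of_nonneg Metric.diam_nonneg s.coe_nonneg, Metric.diam,
    ENNReal.ofReal_toReal hStop] at hmeas

theorem le_dimH_of_measure_closedBall_le [BorelSpace E]
    (hball : ∀ x r, 0 < r → r < 1 →
      μ (Metric.closedBall x r) ≤ ENNReal.ofReal (C * r ^ (s : ℝ)))
    {A : Set E} (hA : μ A ≠ 0) : s ≤ dimH A := by
  set c : ℝ≥0∞ := ENNReal.ofReal C + 1
  have hc : c ≠ ∞ := by simp [c]
  have hle : c⁻¹ • μ ≤ μH[(s : ℝ)] := by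
    refine Measure.le_hausdorffMeasure _ _ (1 / 2) (by simp) fun S hS => ?_
    obtain rfl | hne := S.eq_empty_or_nonempty
    · simp
    rw [Measure.smul_apply, smul_eq_mul, ENNReal.inv_mul_le_iff (by simp [c]) hc]
    calc μ S ≤ ENNReal.ofReal C * Metric.ediam S ^ (s : ℝ) :=
          measure_le_mul_ediam_rpow hball hne (hS.trans_lt (by norm_num))
      _ ≤ c * Metric.ediam S ^ (s : ℝ) := by
          gcongr
          exact le_self_add
  refine le_dimH_of_hausdorffMeasure_ne_zero (ne_bot_of_le_ne_bot ?_ (hle A))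
  simpa [hc] using hA

end MassDistribution

section MoranCut

variable {A I : Type*}

/-- The spliced words of `j + 1` blocks with which the weight `ρ` drops from above `r` to at most
`r`: the `j`-th level of the Moran cover at scale `r`. -/
def moranCut (ρ : List I → ℝ) (ι : A → List I) (t : ℕ → List I) (r : ℝ) (j : ℕ) :
    Set (List I) :=
  {w | ∃ c, splicedWord ι t c (j + 1) = w ∧ ρ w ≤ r ∧ r < ρ (splicedWord ι t c j)}

theorem finite_moranCut [Finite A] (ρ : List I → ℝ) (ι : A → List I) (t : ℕ → List I) (r : ℝ)
    (j : ℕ) : (moranCut ρ ι t r j).Finite :=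
  (finite_range_splicedWord ι t (j + 1)).subset fun _ ⟨c, hc, _⟩ => ⟨c, hc⟩

theorem length_eq_of_mem_moranCut {ρ : List I → ℝ} {ι : A → List I} {n : ℕ}
    (hι : ∀ a, (ι a).length = n) {t : ℕ → List I} {r : ℝ} {j : ℕ} {v w : List I}
    (hv : v ∈ moranCut ρ ι t r j) (hw : w ∈ moranCut ρ ι t r j) : v.length = w.length := by
  obtain ⟨c, rfl, -⟩ := hv
  obtain ⟨c', rfl, -⟩ := hw
  exact length_splicedWord_congr hι t c c' (j + 1)

theorem exists_mem_moranCut {ρ : List I → ℝ} (hnil : ρ [] = 1) {ι : A → List I}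
    {t : ℕ → List I} {c : ℕ → A}
    (hlim : Tendsto (fun j => ρ (splicedWord ι t c j)) atTop (𝓝 0)) {r : ℝ} (hr : 0 < r)
    (hr1 : r < 1) : ∃ j, splicedWord ι t c (j + 1) ∈ moranCut ρ ι t r j := by
  classical
  have hex : ∃ k, ρ (splicedWord ι t c k) ≤ r := (hlim.eventually_le_const hr).exists
  have hzero : Nat.find hex ≠ 0 := by
    rw [Ne, Nat.find_eq_zero]
    exact not_le.2 (hr1.trans_eq hnil.symm)
  obtain ⟨j, hj⟩ := Nat.exists_eq_succ_of_ne_zero hzero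
  have hle := Nat.find_spec hex
  rw [hj] at hle
  exact ⟨j, c, rfl, hle, not_le.1 (Nat.find_min hex (hj ▸ j.lt_succ_self))⟩

theorem IsQuasiMultiplicative.exists_mul_le_of_mem_moranCut [Finite A]
    {ρ : List I → ℝ} {K : ℝ} (hρ : IsQuasiMultiplicative ρ K) (ι : A → List I) :
    ∃ κ > 0, ∀ t r j, ∀ w ∈ moranCut ρ ι t r j, κ * ρ (t j) * r ≤ ρ w := by
  obtain _ | _ := isEmpty_or_nonempty A
  · exact ⟨1, one_pos, fun t r j w ⟨c, _⟩ => isEmptyElim (c 0)⟩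
  obtain ⟨a, ha⟩ := Finite.exists_min fun a => ρ (ι a)
  have hK : 0 < K ^ 2 := pow_pos (one_pos.trans_le hρ.one_le) 2
  refine ⟨ρ (ι a) / K ^ 2, div_pos (hρ.pos _) hK, ?_⟩
  rintro t r j w ⟨c, rfl, -, hlt⟩
  have htj := hρ.pos (t j)
  have hblock : 0 < ρ (ι a) * ρ (t j) := mul_pos (hρ.pos _) htj
  calc ρ (ι a) / K ^ 2 * ρ (t j) * r = r * (ρ (ι a) * ρ (t j)) / K ^ 2 := by ring
    _ ≤ ρ (splicedWord ι t c j) * (ρ (ι (c j)) * ρ (t j)) / K ^ 2 := by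
      have hpos := (hρ.pos (splicedWord ι t c j)).le
      gcongr
      exact ha (c j)
    _ ≤ ρ (splicedWord ι t c (j + 1)) := by
      rw [splicedWord_succ, div_le_iff₀' hK]
      exact hρ.mul_mul_le _ _ _

theorem IsConformalSystem.exists_card_moranCut_le {E : Type*} [NormedAddCommGroup E]
    [InnerProductSpace ℝ E] [FiniteDimensional ℝ E] [Nontrivial E] {X V : Set E} {φ : I → E → E}
    {K : ℝ} (h : IsConformalSystem X V φ K) {x₀ : E} (hx₀ : x₀ ∈ interior X) [Finite A]
    {ι : A → List I} {n : ℕ} (hι : ∀ a, (ι a).length = n) {t : ℕ → List I}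
    (ht : ∀ j, (1 / 2 : ℝ) ^ (j + 1) ≤ wordScale φ x₀ (t j) ^ Module.finrank ℝ E) :
    ∃ M : ℝ, 0 ≤ M ∧ ∀ (x : E) (r : ℝ) (j : ℕ) (T : Finset (List I)), 0 < r →
      (∀ w ∈ T, w ∈ moranCut (wordScale φ x₀) ι t r j) →
      (∀ w ∈ T, (wordMap φ w '' X ∩ Metric.closedBall x r).Nonempty) →
      (T.card : ℝ) ≤ M * 2 ^ (j + 1) := by
  have hρ := h.isQuasiMultiplicative_wordScale (h.subset (interior_subset hx₀))
  obtain ⟨M, hM, hcard⟩ := h.exists_card_mul_pow_le hx₀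
  obtain ⟨κ, hκ, hle⟩ := hρ.exists_mul_le_of_mem_moranCut ι
  set d := Module.finrank ℝ E
  refine ⟨M / κ ^ d, by positivity, fun x r j T hr hT hmeet => ?_⟩
  obtain rfl | ⟨v, hv⟩ := T.eq_empty_or_nonempty
  · simp only [Finset.card_empty, Nat.cast_zero]
    positivity
  have htj := hρ.pos (t j)
  have hbound := hcard T v.length x (κ * wordScale φ x₀ (t j) * r) r (by positivity) hr.le
    (fun w hw => length_eq_of_mem_moranCut hι (hT w hw) (hT v hv))
    (fun w hw => ⟨hle t r j w (hT w hw), (hT w hw).elim fun _ hc => hc.2.1⟩) hmeet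
  rw [mul_pow, ← mul_assoc, mul_le_mul_iff_of_pos_right (pow_pos hr d), mul_pow] at hbound
  have hcut : T.card * κ ^ d * (1 / 2) ^ (j + 1) ≤ M := by
    refine le_trans ?_ ((mul_assoc _ _ _).trans_le hbound)
    gcongr
    exact ht j
  calc (T.card : ℝ) = T.card * κ ^ d * (1 / 2) ^ (j + 1) * (2 ^ (j + 1) / κ ^ d) := by
        rw [one_div, inv_pow]
        field_simp
    _ ≤ M * (2 ^ (j + 1) / κ ^ d) := by gcongr
    _ = M / κ ^ d * 2 ^ (j + 1) := by ring

theorem measure_le_of_card_splicedWord_le [MeasurableSpace A] {ρ : List I → ℝ} {ι : A → List I}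
    {t : ℕ → List I} {μ : Measure (ℕ → A)}
    (hμ : ∀ w j, μ {c | splicedWord ι t c j = w} ≤ ENNReal.ofReal ((1 / 4) ^ j * ρ w))
    {S : Set (ℕ → A)} {T : ℕ → Finset (List I)}
    (hcover : ∀ c ∈ S, ∃ j, splicedWord ι t c (j + 1) ∈ T j) {δ M : ℝ} (hδ : 0 ≤ δ) (hM : 0 ≤ M)
    (hT : ∀ j, ∀ w ∈ T j, ρ w ≤ δ) (hcard : ∀ j, ((T j).card : ℝ) ≤ M * 2 ^ (j + 1)) :
    μ S ≤ ENNReal.ofReal (M * δ) := by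
  have hlevel : ∀ j, μ (⋃ w ∈ T j, {c | splicedWord ι t c (j + 1) = w}) ≤
      ENNReal.ofReal (M * δ / 2 / 2 ^ j) := fun j =>
    calc μ (⋃ w ∈ T j, {c | splicedWord ι t c (j + 1) = w})
        ≤ ∑ w ∈ T j, μ {c | splicedWord ι t c (j + 1) = w} := measure_biUnion_finset_le _ _
      _ ≤ (T j).card • ENNReal.ofReal ((1 / 4) ^ (j + 1) * δ) :=
        Finset.sum_le_card_nsmul _ _ _ fun w hw => (hμ w (j + 1)).trans (by
          gcongr
          exact hT j w hw)
      _ = ENNReal.ofReal ((T j).card * ((1 / 4) ^ (j + 1) * δ)) := by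
        rw [nsmul_eq_mul, ENNReal.ofReal_mul (Nat.cast_nonneg _), ENNReal.ofReal_natCast]
      _ ≤ ENNReal.ofReal (M * 2 ^ (j + 1) * ((1 / 4) ^ (j + 1) * δ)) := by
        gcongr
        exact hcard j
      _ = ENNReal.ofReal (M * δ / 2 / 2 ^ j) := by
        rw [show (1 / 4 : ℝ) = (2 * 2)⁻¹ by norm_num, inv_pow, mul_pow, pow_succ]
        field_simp
  calc μ S ≤ μ (⋃ j, ⋃ w ∈ T j, {c | splicedWord ι t c (j + 1) = w}) := by
        refine measure_mono fun c hc => ?_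
        simpa using hcover c hc
    _ ≤ ∑' j, ENNReal.ofReal (M * δ / 2 / 2 ^ j) :=
        (measure_iUnion_le _).trans (ENNReal.tsum_le_tsum hlevel)
    _ = ENNReal.ofReal (M * δ) := by
        rw [← ENNReal.ofReal_tsum_of_nonneg (fun j => by positivity) (summable_geometric_two' _),
          tsum_geometric_two']

end MoranCut

section SplicedLimit

variable {A I : Type*} {ι : A → List I}

theorem append_ne_nil_of_length_eq_succ {n : ℕ} (hι : ∀ a, (ι a).length = n + 1) (a : A)
    (w : List I) : ι a ++ w ≠ [] :=
  List.append_ne_nil_of_left_ne_nil (List.ne_nil_of_length_eq_add_one (hι a)) w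

theorem tendsto_splicedWord_comap_length {n : ℕ} (hι : ∀ a, (ι a).length = n + 1)
    (t : ℕ → List I) (c : ℕ → A) :
    Tendsto (splicedWord ι t c) atTop (comap List.length atTop) :=
  tendsto_comap_iff.2 (tendsto_atTop_mono
    (le_length_prefixConcat fun _ => append_ne_nil_of_length_eq_succ hι _ _) tendsto_id)

end SplicedLimit

namespace IsConformalSystem

section Coding

variable {I E : Type*} [NormedAddCommGroup E] [InnerProductSpace ℝ E] {X V : Set E}
  {φ : I → E → E} {K : ℝ}

theorem tendsto_of_mem_word_image (h : IsConformalSystem X V φ K) {w : ℕ → List I}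
    (hw : Tendsto w atTop (comap List.length atTop)) {x y : E} (hx : x ∈ X)
    (hy : ∀ j, y ∈ wordMap φ (w j) '' X) :
    Tendsto (fun j => wordMap φ (w j) x) atTop (𝓝 y) := by
  obtain ⟨C, -, hdist⟩ := h.exists_dist_le hx
  have hscale : Tendsto (fun j => C * wordScale φ x (w j)) atTop (𝓝 0) := by
    simpa using ((h.tendsto_wordScale x hx).comp hw).const_mul C
  refine tendsto_iff_dist_tendsto_zero.2 (squeeze_zero (fun _ => dist_nonneg) (fun j => ?_) hscale)
  obtain ⟨z, hz, rfl⟩ := hy j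
  exact hdist (w j) x hx z hz

theorem exists_isCodedBy (h : IsConformalSystem X V φ K) (hX : X.Nonempty) (ω : ℕ → I) :
    ∃ x, IsCodedBy X φ ω x := by
  have hanti : ∀ n, wordMap φ ((List.range (n + 1)).map ω) '' X ⊆
      wordMap φ ((List.range n).map ω) '' X := fun n => by
    rw [List.range_succ, List.map_append, wordMap_append, image_comp]
    exact image_mono (h.word_mapsTo_X _).image_subset
  obtain ⟨x, hx⟩ := IsCompact.nonempty_iInter_of_sequence_nonempty_isCompact_isClosed
    (fun n => wordMap φ ((List.range n).map ω) '' X) hanti (fun n => hX.image _)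
    (h.isCompact_word_image _) fun n => (h.isCompact_word_image _).isClosed
  have hlen : Tendsto (fun n => (List.range (n + 1)).map ω) atTop (comap List.length atTop) :=
    tendsto_comap_iff.2 (by simpa [Function.comp_def] using tendsto_add_atTop_nat 1)
  refine ⟨x, subset_antisymm (fun y hy => ?_) ?_⟩
  · obtain ⟨z, hz⟩ := hX
    exact tendsto_nhds_unique
      (h.tendsto_of_mem_word_image hlen hz fun n => mem_iInter₂.1 hy (n + 1) n.succ_pos)
      (h.tendsto_of_mem_word_image hlen hz fun n => mem_iInter.1 hx (n + 1))
  · exact singleton_subset_iff.2 (mem_iInter₂.2 fun n _ => mem_iInter.1 hx n)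

theorem mem_word_image_of_isCodedBy (h : IsConformalSystem X V φ K) {ω : ℕ → I} {x : E}
    (hx : IsCodedBy X φ ω x) (n : ℕ) : x ∈ wordMap φ ((List.range n).map ω) '' X := by
  have hmem := fun m (hm : 1 ≤ m) => mem_iInter₂.1 (hx.symm.subset rfl) m hm
  obtain rfl | hn := n.eq_zero_or_pos
  · exact ⟨x, (h.word_mapsTo_X _).image_subset (hmem 1 le_rfl), rfl⟩
  · exact hmem n hn

end Coding

theorem exists_mem_denseLimitSet_word_image {E : Type*} [NormedAddCommGroup E]
    [InnerProductSpace ℝ E] {X V : Set E} {φ : ℕ → E → E} {K : ℝ}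
    (h : IsConformalSystem X V φ K) (hX : X.Nonempty) {b : ℕ → List ℕ} (hb : ∀ j, b j ≠ [])
    (hw : ∀ w, ∃ j, w <:+ b j) :
    ∃ x ∈ denseLimitSet X φ, ∀ j, x ∈ wordMap φ (prefixConcat b j) '' X := by
  obtain ⟨x, hx⟩ := h.exists_isCodedBy hX (concatSeq b)
  refine ⟨x, ⟨_, concatSeq_mem_denseSequences hb hw, hx⟩, fun j => ?_⟩
  rw [← map_range_concatSeq hb j]
  exact h.mem_word_image_of_isCodedBy hx _

section Measure

variable {A I E : Type*} [NormedAddCommGroup E] [InnerProductSpace ℝ E] {X V : Set E}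
  {φ : I → E → E} {K : ℝ}

theorem measurable_of_mem_splicedWord_image [Countable I] [Countable A] [MeasurableSpace A]
    [MeasurableSingletonClass A] [MeasurableSpace E] [BorelSpace E]
    (h : IsConformalSystem X V φ K) (hX : X.Nonempty) {ι : A → List I} {n : ℕ}
    (hι : ∀ a, (ι a).length = n + 1) {t : ℕ → List I} {π : (ℕ → A) → E}
    (hπ : ∀ c j, π c ∈ wordMap φ (splicedWord ι t c j) '' X) : Measurable π := by
  obtain ⟨x, hx⟩ := hX
  refine measurable_of_tendsto_metrizable
    (measurable_apply_splicedWord (fun w => wordMap φ w x) ι t) (tendsto_pi_nhds.2 fun c => ?_)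
  exact h.tendsto_of_mem_word_image (tendsto_splicedWord_comap_length hι t c) hx (hπ c)

theorem exists_measure_preimage_closedBall_le [FiniteDimensional ℝ E] [Nontrivial E] [Finite A]
    [MeasurableSpace A] (h : IsConformalSystem X V φ K) {x₀ : E} (hx₀ : x₀ ∈ interior X)
    {ι : A → List I} {n : ℕ} (hι : ∀ a, (ι a).length = n + 1) {t : ℕ → List I}
    (ht : ∀ j, (1 / 2 : ℝ) ^ (j + 1) ≤ wordScale φ x₀ (t j) ^ Module.finrank ℝ E)
    {s : ℝ} (hs : 0 ≤ s) {μ : Measure (ℕ → A)}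
    (hμ : ∀ w j, μ {c | splicedWord ι t c j = w} ≤
      ENNReal.ofReal ((1 / 4) ^ j * wordScale φ x₀ w ^ s))
    {π : (ℕ → A) → E} (hπ : ∀ c j, π c ∈ wordMap φ (splicedWord ι t c j) '' X) :
    ∃ C : ℝ, ∀ x r, 0 < r → r < 1 →
      μ (π ⁻¹' Metric.closedBall x r) ≤ ENNReal.ofReal (C * r ^ s) := by
  classical
  obtain ⟨M, hM, hcard⟩ := h.exists_card_moranCut_le hx₀ hι ht
  refine ⟨M, fun x r hr hr1 => ?_⟩
  let T : ℕ → Finset (List I) := fun j =>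
    {w ∈ (finite_moranCut (wordScale φ x₀) ι t r j).toFinset |
      (wordMap φ w '' X ∩ Metric.closedBall x r).Nonempty}
  have hT : ∀ {j w}, w ∈ T j ↔ w ∈ moranCut (wordScale φ x₀) ι t r j ∧
      (wordMap φ w '' X ∩ Metric.closedBall x r).Nonempty := by simp [T]
  refine measure_le_of_card_splicedWord_le hμ (T := T) (fun c hc => ?_)
    (Real.rpow_nonneg hr.le s) hM (fun j w hw => ?_) fun j => ?_
  · have hlim := (h.tendsto_wordScale x₀ (interior_subset hx₀)).comp
      (tendsto_splicedWord_comap_length hι t c)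
    obtain ⟨j, hj⟩ := exists_mem_moranCut (wordScale_nil φ x₀) hlim hr hr1
    exact ⟨j, hT.2 ⟨hj, π c, hπ c (j + 1), hc⟩⟩
  · obtain ⟨-, -, hle, -⟩ := (hT.1 hw).1
    exact Real.rpow_le_rpow (norm_nonneg _) hle hs
  · exact hcard x r j (T j) hr (fun w hw => (hT.1 hw).1) fun w hw => (hT.1 hw).2

end Measure

section HausdorffMeasure

variable {I E : Type*} [NormedAddCommGroup E] [InnerProductSpace ℝ E] {X V : Set E}
  {φ : I → E → E} {K : ℝ}

theorem exists_ediam_word_image_le (h : IsConformalSystem X V φ K) {x₀ : E} (hx₀ : x₀ ∈ X) :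
    ∃ C : ℝ, 0 ≤ C ∧
      ∀ w, Metric.ediam (wordMap φ w '' X) ≤ ENNReal.ofReal (C * wordScale φ x₀ w) := by
  obtain ⟨C, hC, hdist⟩ := h.exists_dist_le hx₀
  refine ⟨C, hC, fun w => Metric.ediam_le ?_⟩
  rintro _ ⟨x, hx, rfl⟩ _ ⟨y, hy, rfl⟩
  rw [edist_dist]
  exact ENNReal.ofReal_le_ofReal (hdist w x hx y hy)

theorem tendsto_iSup_ediam_word_image (h : IsConformalSystem X V φ K) :
    Tendsto (fun n => ⨆ w : {w : List I // w.length = n}, Metric.ediam (wordMap φ w '' X)) atTop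
      (𝓝 0) := by
  obtain rfl | ⟨x₀, hx₀⟩ := X.eq_empty_or_nonempty
  · simp
  obtain ⟨C, -, hC⟩ := h.exists_ediam_word_image_le hx₀
  have hscale : Tendsto (fun w => ENNReal.ofReal (C * wordScale φ x₀ w))
      (comap List.length atTop) (𝓝 0) := by
    simpa using ENNReal.tendsto_ofReal ((h.tendsto_wordScale x₀ hx₀).const_mul C)
  refine ENNReal.tendsto_nhds_zero.2 fun ε hε => ?_
  filter_upwards [eventually_comap.1 (ENNReal.tendsto_nhds_zero.1 hscale ε hε)] with n hn
  exact iSup_le fun w => (hC w).trans (hn w w.2)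

theorem hausdorffMeasure_limitSet_le [Countable I] [MeasurableSpace E] [BorelSpace E]
    (h : IsConformalSystem X V φ K) (s : ℝ) {c : ℝ≥0∞}
    (hc : ∀ n, ∑' w : {w : List I // w.length = n + 1},
      Metric.ediam (wordMap φ w '' X) ^ s ≤ c) : μH[s] (limitSet X φ) ≤ c := by
  refine (Measure.hausdorffMeasure_le_liminf_tsum s (limitSet X φ) _
    ((tendsto_add_atTop_iff_nat 1).2 h.tendsto_iSup_ediam_word_image)
    (fun n (w : {w : List I // w.length = n + 1}) => wordMap φ w '' X)
    (Eventually.of_forall fun n w => le_iSup_of_le w le_rfl)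
    (Eventually.of_forall fun n x hx => ?_)).trans ?_
  · simpa [limitSet] using mem_iInter₂.1 hx (n + 1) n.succ_pos
  · exact liminf_le_of_le (by isBoundedDefault) fun b hb =>
      hb.exists.elim fun n hn => hn.trans (hc n)

theorem exists_lt_sum_wordScale_rpow [Countable I] [MeasurableSpace E] [BorelSpace E]
    (h : IsConformalSystem X V φ K) {x₀ : E} (hx₀ : x₀ ∈ X) {s : ℝ} (hs : 0 ≤ s)
    (htop : μH[s] (limitSet X φ) = ∞) (B : ℝ) :
    ∃ (n k : ℕ) (ι : Fin k → List I), Function.Injective ι ∧ (∀ a, (ι a).length = n + 1) ∧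
      B < ∑ a, wordScale φ x₀ (ι a) ^ s := by
  suffices ∃ (n : ℕ) (F : Finset {w : List I // w.length = n + 1}),
      B < ∑ w ∈ F, wordScale φ x₀ w ^ s by
    obtain ⟨n, F, hF⟩ := this
    refine ⟨n, F.card, fun a => F.equivFin.symm a, ?_, fun a => (F.equivFin.symm a).1.2, ?_⟩
    · exact Subtype.val_injective.comp (Subtype.val_injective.comp F.equivFin.symm.injective)
    · rwa [F.equivFin.symm.sum_comp (fun w => wordScale φ x₀ w ^ s),
        Finset.sum_coe_sort F fun w => wordScale φ x₀ w ^ s]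
  by_contra! hB
  obtain ⟨C, hC, hdiam⟩ := h.exists_ediam_word_image_le hx₀
  refine (h.hausdorffMeasure_limitSet_le s (c := ENNReal.ofReal (C ^ s * B)) fun n => ?_).not_gt
    (htop ▸ ENNReal.ofReal_lt_top)
  rw [ENNReal.tsum_eq_iSup_sum]
  refine iSup_le fun F => ?_
  have hscale : ∀ w, 0 ≤ wordScale φ x₀ w := fun w => norm_nonneg _
  calc ∑ w ∈ F, Metric.ediam (wordMap φ w '' X) ^ s
      ≤ ∑ w ∈ F, ENNReal.ofReal (C ^ s * wordScale φ x₀ w ^ s) := by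
        refine Finset.sum_le_sum fun w _ => ?_
        rw [← Real.mul_rpow hC (hscale w),
          ← ENNReal.ofReal_rpow_of_nonneg (mul_nonneg hC (hscale w)) hs]
        exact ENNReal.rpow_le_rpow (hdiam w) hs
    _ = ENNReal.ofReal (C ^ s * ∑ w ∈ F, wordScale φ x₀ w ^ s) := by
        rw [Finset.mul_sum]
        refine (ENNReal.ofReal_sum_of_nonneg fun w _ => ?_).symm
        exact mul_nonneg (Real.rpow_nonneg hC s) (Real.rpow_nonneg (hscale w) s)
    _ ≤ ENNReal.ofReal (C ^ s * B) := by
        refine ENNReal.ofReal_le_ofReal ?_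
        exact mul_le_mul_of_nonneg_left (hB n F) (Real.rpow_nonneg hC s)

end HausdorffMeasure

end IsConformalSystem

section DenseLimitSet

variable {E : Type*} [NormedAddCommGroup E] [InnerProductSpace ℝ E] {X V : Set E} {φ : ℕ → E → E}
  {K : ℝ}

theorem denseLimitSet_subset_limitSet {E : Type*} (X : Set E) (φ : ℕ → E → E) :
    denseLimitSet X φ ⊆ limitSet X φ := by
  rintro x ⟨ω, -, hx⟩
  refine mem_iInter₂.2 fun n hn => mem_iUnion₂.2 ⟨(List.range n).map ω, by simp, ?_⟩
  exact mem_iInter₂.1 (hx.symm.subset rfl) n hn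

theorem IsConformalSystem.exists_spliced_measure [Nontrivial E] [MeasurableSpace E] [BorelSpace E]
    (h : IsConformalSystem X V φ K) {x₀ : E} (hx₀ : x₀ ∈ X) {s : ℝ} (hs : 0 ≤ s)
    (htop : μH[s] (limitSet X φ) = ∞) :
    ∃ (n k : ℕ) (ι : Fin k → List ℕ) (t : ℕ → List ℕ) (μ : Measure (ℕ → Fin k)),
      (∀ a, (ι a).length = n + 1) ∧ Function.Surjective t ∧
      (∀ j, (1 / 2 : ℝ) ^ (j + 1) ≤ wordScale φ x₀ (t j) ^ Module.finrank ℝ E) ∧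
      IsProbabilityMeasure μ ∧ ∀ w j, μ {c | splicedWord ι t c j = w} ≤
        ENNReal.ofReal ((1 / 4) ^ j * wordScale φ x₀ w ^ s) := by
  have hρ := h.isQuasiMultiplicative_wordScale (h.subset hx₀)
  obtain ⟨n, k, ι, hinj, hι, hsum⟩ := h.exists_lt_sum_wordScale_rpow hx₀ hs htop (8 * (K ^ s) ^ 2)
  obtain ⟨t, ht, hprod, hpow⟩ := exists_surjective_pow_le_prod_and_pow_le (hρ.rpow hs).pos
    (fun w => pow_pos (hρ.pos w) (Module.finrank ℝ E)) (hρ.rpow hs).nil (by simp [hρ.nil])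
  obtain ⟨μ, hprob, hμ⟩ := (hρ.rpow hs).exists_measure_splicedWord_le hinj hι hsum.le hprod
  exact ⟨n, k, ι, t, μ, hι, ht, hpow, hprob, hμ⟩

theorem IsConformalSystem.le_dimH_denseLimitSet [FiniteDimensional ℝ E] [Nontrivial E]
    [MeasurableSpace E] [BorelSpace E] (h : IsConformalSystem X V φ K) (hX : (interior X).Nonempty)
    {s : ℝ≥0} (htop : μH[(s : ℝ)] (limitSet X φ) = ∞) : s ≤ dimH (denseLimitSet X φ) := by
  obtain ⟨x₀, hx₀⟩ := hX
  have hne : X.Nonempty := ⟨x₀, interior_subset hx₀⟩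
  obtain ⟨n, k, ι, t, μ, hι, ht, hpow, hprob, hμ⟩ :=
    h.exists_spliced_measure (interior_subset hx₀) s.coe_nonneg htop
  have hpoint : ∀ c : ℕ → Fin k, ∃ x ∈ denseLimitSet X φ,
      ∀ j, x ∈ wordMap φ (splicedWord ι t c j) '' X := fun c =>
    h.exists_mem_denseLimitSet_word_image hne
      (fun _ => append_ne_nil_of_length_eq_succ hι _ _)
      fun w => (ht w).imp fun j (hj : t j = w) => hj ▸ List.suffix_append _ _
  choose π hmem hπ using hpoint
  have hmeas : Measurable π := h.measurable_of_mem_splicedWord_image hne hι hπ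
  obtain ⟨C, hC⟩ := h.exists_measure_preimage_closedBall_le hx₀ hι hpow s.coe_nonneg hμ hπ
  have hmap : (μ.map π) (denseLimitSet X φ) ≠ 0 := by
    have hrange : μ univ ≤ μ.map π (denseLimitSet X φ) :=
      (measure_mono fun c _ => hmem c).trans (Measure.le_map_apply hmeas.aemeasurable _)
    exact ((measure_univ (μ := μ) ▸ one_pos).trans_le hrange).ne'
  refine le_dimH_of_measure_closedBall_le (μ := μ.map π) (C := C) (fun x r hr hr1 => ?_) hmap
  rw [Measure.map_apply hmeas Metric.isClosed_closedBall.measurableSet]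
  exact hC x r hr hr1

end DenseLimitSet

theorem IsConformalIFS.exists_isConformalSystem {d : ℕ} {I : Type*}
    {X : Set (EuclideanSpace ℝ (Fin d))}
    {φ : I → EuclideanSpace ℝ (Fin d) → EuclideanSpace ℝ (Fin d)} (hΦ : IsConformalIFS X φ) :
    ∃ V K, IsConformalSystem X V φ K := by
  obtain ⟨V, hV, hVc, hXV, hφ, K, hK, hdist⟩ := hΦ.conformal
  obtain ⟨η, N, hη, hη1, hcontr⟩ := hΦ.contraction
  refine ⟨V, K, hΦ.isCompact, hV, hVc.isPreconnected, hXV, hΦ.mapsTo, fun i => (hφ i).1,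
    fun i => (hφ i).2.1, fun i => (hφ i).2.2.1, fun i => (hφ i).2.2.2, hΦ.openSet, hK,
    fun w x hx y hy => ?_, fun x hx => ?_⟩
  · obtain rfl | hw := eq_or_ne w []
    · simp only [wordScale, wordMap, fderiv_id]
      exact le_mul_of_one_le_left (norm_nonneg _) hK
    · exact hdist w hw x hx y hy
  · have hpow : Tendsto (fun w : List I => η ^ (w.length - 1)) (comap List.length atTop) (𝓝 0) :=
      ((tendsto_pow_atTop_nhds_zero_of_lt_one hη hη1).comp (tendsto_sub_atTop_nat 1)).comp
        tendsto_comap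
    refine squeeze_zero' (Eventually.of_forall fun _ => norm_nonneg _) ?_ hpow
    filter_upwards [tendsto_comap.eventually_ge_atTop (N + 1)] with w hw
    exact hcontr (w.length - 1) (by lia) w (by lia) x hx

theorem mainTheorem6_general {E : Type*} [NormedAddCommGroup E] [InnerProductSpace ℝ E]
    [FiniteDimensional ℝ E] {X V : Set E} {φ : ℕ → E → E} {K : ℝ} (h : IsConformalSystem X V φ K)
    (hX : X.Nonempty → (interior X).Nonempty) :
    dimH (denseLimitSet X φ) = dimH (limitSet X φ) := by
  borelize E
  refine (dimH_mono (denseLimitSet_subset_limitSet X φ)).antisymm ?_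
  obtain hE | hE := subsingleton_or_nontrivial E
  · exact (dimH_subsingleton (subsingleton_of_subsingleton)).trans_le zero_le
  refine dimH_le fun s htop => h.le_dimH_denseLimitSet (hX ?_) htop
  obtain ⟨x, hx⟩ := nonempty_of_measure_ne_zero (htop ▸ ENNReal.top_ne_zero)
  obtain ⟨w, -, y, hy, -⟩ := mem_iUnion₂.1 (mem_iInter₂.1 hx 1 le_rfl)
  exact ⟨y, hy⟩

theorem mainTheorem6 (d : ℕ) (X : Set (EuclideanSpace ℝ (Fin d)))
    (φ : ℕ → EuclideanSpace ℝ (Fin d) → EuclideanSpace ℝ (Fin d))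
    (hΦ : IsConformalIFS X φ) :
    dimH (denseLimitSet X φ) = dimH (limitSet X φ) := by
  obtain ⟨V, K, h⟩ := hΦ.exists_isConformalSystem
  exact mainTheorem6_general h fun hX =>
    closure_nonempty_iff.1 (hΦ.closure_interior.symm ▸ hX)
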